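/- All vector lattices are real and Archimedean, and all linear topologies are Hausdorff. A locally solid topology on a vector lattice is a linear topology for which zero has a neighbourhood basis of solid sets. A net $(x_\alpha)$ in a vector lattice $E$ is order convergent to $x$ if there is a net $y_\beta\downarrow 0$ in $E$ such that for every $\beta_0$ there is an $\alpha_0$ with $|x_\alpha-x|\le y_{\beta_0}$ for all $\alpha\ge\alpha_0$; a set is order closed if it contains the order limits of all nets in it. A locally solid topology is a Fatou topology if zero has a neighbourhood basis of order closed solid sets, and an o-Lebesgue topology if every order convergent net converges topologically to its order limit. Write $B_x$ for the band generated by $x$ and $A^{\mathrm d}$ for the disjoint complement of $A$. A locally solid topology $\tau$ on $E$ is *solidly submetrisable* if it is finer than some metrisable locally solid topology on $E$; *locally solidly submetrisable* if $\tau|_{B_x}$ is solidly submetrisable for every $x\in E$; and *locally interval complete solidly submetrisable* if, for every $x\in E$ with $x\ge 0$, there is a metrisable locally solid topology $\widetilde\tau_x$ on $B_x$ that is coarser than $\tau|_{B_x}$ and such that every $\widetilde\tau_x$-Cauchy sequence in the order interval $[0,x]$ is $\widetilde\tau_x$-convergent to an element of $[0,x]$. The *carrier* $C_\tau$ is the union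 of the sets $\bigl(\bigcap_n V_n\bigr)^{\mathrm d}$ over all sequences $(V_n)_{n\ge 1}$ of solid $\tau$-neighbourhoods of zero with $V_{n+1}+V_{n+1}\subseteq V_n$ for all $n$. $E$ has the *countable sup property* if every subset of $E$ that has a supremum contains an at most countable subset with the same supremum. **Theorem.** Let $\tau$ be a Fatou topology on a vector lattice $E$. Let $E^\delta$ be the Dedekind completion of $E$, i.e. a Dedekind complete vector lattice that contains $E$ as an order dense and majorising vector sublattice, and let $\tau^\delta$ be the Fatou topology on $E^\delta$ that extends $\tau$, i.e. whose restriction to $E$ is $\tau$. The following are equivalent: 1. $\tau$ is locally solidly submetrisable; 2. $\tau^\delta$ is locally solidly submetrisable; 3. $\tau^\delta$ is locally interval complete solidly submetrisable; 4. $C_\tau=E$; 5. $C_{\tau^\delta}=E^\delta$. If $\tau$ is an o-Lebesgue topology, then (1)–(5) are also equivalent to: 6. $E$ has the countable sup property. -/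

import Mathlib

universe u v

namespace VectorLattice

open Set Filter Topology LatticeOrderedAddCommGroup
open scoped Pointwise

section Basic

/- A vector lattice is a real vector space `E` with a lattice order that is compatible with
addition and with multiplication by non-negative scalars. -/
variable (E : Type u) [AddCommGroup E] [Module ℝ E] [Lattice E] [IsOrderedAddMonoid E]
  [IsOrderedModule ℝ E]

/-- The Archimedean property of vector lattices: if all multiples `n x` are bounded above by one
element `y`, then `x ≤ 0`. (This is not Mathlib's class `Archimedean`.) -/
def IsArchimedean : Prop :=
  ∀ x y : E, (∀ n : ℕ, n • x ≤ y) → x ≤ 0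

/-- Dedekind completeness: every non-empty subset that is bounded above has a supremum. -/
def IsDedekindComplete : Prop :=
  ∀ S : Set E, S.Nonempty → BddAbove S → ∃ x, IsLUB S x

/-- The countable sup property: every subset that has a supremum contains an at most countable
subset with the same supremum. -/
def CountableSupProperty : Prop :=
  ∀ (S : Set E) (x : E), IsLUB S x → ∃ T ⊆ S, T.Countable ∧ IsLUB T x

variable {E}

/-- Order convergence of a net `f` to `x`: there is a net `y` with `y ↓ 0` such that every `y b`
eventually dominates `|f a - x|`. -/
def OrderConverges {A : Type u} [Preorder A] (f : A → E) (x : E) : Prop :=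
  ∃ (B : Type u) (_ : Preorder B) (_ : IsDirectedOrder B) (_ : Nonempty B) (y : B → E),
    Antitone y ∧ IsGLB (range y) 0 ∧ ∀ b₀ : B, ∃ a₀ : A, ∀ a : A, a₀ ≤ a → |f a - x| ≤ y b₀

/-- A set is order closed if it contains the order limits of all its nets. (Nets indexed by
directed sets in the universe of `E` are enough to describe all nets in `E`.) -/
def IsOrderClosed (S : Set E) : Prop :=
  ∀ (A : Type u) [Preorder A] [IsDirectedOrder A] [Nonempty A] (f : A → E) (x : E),
    (∀ a, f a ∈ S) → OrderConverges f x → x ∈ S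

/-- The disjoint complement of a set. -/
def disjointComplement (S : Set E) : Set E :=
  {y | ∀ z ∈ S, |y| ⊓ |z| = 0}

/-- A band is an order closed ideal, an ideal being a solid linear subspace. -/
def IsBand (B : Submodule ℝ E) : Prop :=
  IsSolid (B : Set E) ∧ IsOrderClosed (B : Set E)

/-- The band `B_x` generated by `x`: the smallest band that contains `x`. -/
def principalBand (x : E) : Submodule ℝ E :=
  sInf {B : Submodule ℝ E | IsBand B ∧ x ∈ B}

theorem isSolid_principalBand (x : E) : IsSolid (principalBand x : Set E) := by
  intro a ha b hab
  simp only [principalBand, SetLike.mem_coe, Submodule.mem_sInf] at ha ⊢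
  exact fun B hB => hB.1.1 (ha B hB) hab

theorem abs_mem_principalBand {x a : E} (ha : a ∈ principalBand x) : |a| ∈ principalBand x :=
  isSolid_principalBand x ha (by rw [abs_abs])

theorem abs_sup_le_abs_add (a b : E) : |a ⊔ b| ≤ |a| + |b| := by
  have ha := abs_nonneg a
  have hb := abs_nonneg b
  refine sup_le (sup_le ?_ ?_) ?_
  · exact (le_abs_self a).trans (le_add_of_nonneg_right hb)
  · exact (le_abs_self b).trans (le_add_of_nonneg_left ha)
  · rw [neg_sup]
    exact inf_le_left.trans ((neg_le_abs a).trans (le_add_of_nonneg_right hb))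

theorem sup_mem_principalBand {x a b : E} (ha : a ∈ principalBand x)
    (hb : b ∈ principalBand x) : a ⊔ b ∈ principalBand x :=
  isSolid_principalBand x
    ((principalBand x).add_mem (abs_mem_principalBand ha) (abs_mem_principalBand hb))
    ((abs_sup_le_abs_add a b).trans (le_abs_self _))

theorem inf_mem_principalBand {x a b : E} (ha : a ∈ principalBand x)
    (hb : b ∈ principalBand x) : a ⊓ b ∈ principalBand x := by
  have h := (principalBand x).neg_mem (sup_mem_principalBand
    ((principalBand x).neg_mem ha) ((principalBand x).neg_mem hb))
  rwa [neg_sup, neg_neg, neg_neg] at h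

/-- `B_x` is a vector lattice in the order and with the lattice operations of `E`. -/
instance instLatticePrincipalBand (x : E) : Lattice (principalBand x) :=
  Subtype.lattice (fun _ _ => sup_mem_principalBand) (fun _ _ => inf_mem_principalBand)

instance instIsOrderedAddMonoidPrincipalBand (x : E) : IsOrderedAddMonoid (principalBand x) where
  add_le_add_left _ _ h c := add_le_add_left (α := E) h c

instance instIsOrderedModulePrincipalBand (x : E) : IsOrderedModule ℝ (principalBand x) where
  smul_le_smul_of_nonneg_left _ hr _ _ h := smul_le_smul_of_nonneg_left (β := E) h hr
  smul_le_smul_of_nonneg_right _ hb _ _ h := smul_le_smul_of_nonneg_right (β := E) h hb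

end Basic

section Topologies

variable {E : Type u} [AddCommGroup E] [Module ℝ E] [Lattice E] [IsOrderedAddMonoid E]
  [IsOrderedModule ℝ E]

/-- A locally solid topology: a Hausdorff linear topology for which zero has a neighbourhood basis
of solid sets. -/
structure IsLocallySolid (τ : TopologicalSpace E) : Prop where
  isTopologicalAddGroup : @IsTopologicalAddGroup E τ _
  continuousSMul : @ContinuousSMul ℝ E _ _ τ
  t2Space : @T2Space E τ
  solid_basis : ∀ U ∈ @nhds E τ 0, ∃ V ∈ @nhds E τ 0, IsSolid V ∧ V ⊆ U

/-- A Fatou topology: a locally solid topology for which zero has a neighbourhood basis of order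
closed solid sets. -/
structure IsFatou (τ : TopologicalSpace E) : Prop where
  isLocallySolid : IsLocallySolid τ
  orderClosed_basis :
    ∀ U ∈ @nhds E τ 0, ∃ V ∈ @nhds E τ 0, IsSolid V ∧ IsOrderClosed V ∧ V ⊆ U

/-- An o-Lebesgue topology: a locally solid topology for which every order convergent net is
convergent to the same limit. -/
structure IsOLebesgue (τ : TopologicalSpace E) : Prop where
  isLocallySolid : IsLocallySolid τ
  tendsto : ∀ (A : Type u) [Preorder A] [IsDirectedOrder A] [Nonempty A] (f : A → E) (x : E),
    OrderConverges f x → Tendsto f atTop (@nhds E τ x)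

/-- A normal sequence of solid neighbourhoods of zero. -/
def IsNormalSeq (τ : TopologicalSpace E) (V : ℕ → Set E) : Prop :=
  (∀ n, V n ∈ @nhds E τ 0 ∧ IsSolid (V n)) ∧ ∀ n, V (n + 1) + V (n + 1) ⊆ V n

/-- The carrier `C_τ`: the union of the disjoint complements of the intersections of all normal
sequences of solid neighbourhoods of zero. -/
def carrier (τ : TopologicalSpace E) : Set E :=
  {x | ∃ V : ℕ → Set E, IsNormalSeq τ V ∧ x ∈ disjointComplement (⋂ n, V n)}

/-- `τ` is solidly submetrisable: it is finer than some metrisable locally solid topology. -/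
def IsSolidlySubmetrisable (τ : TopologicalSpace E) : Prop :=
  ∃ σ : TopologicalSpace E,
    IsLocallySolid σ ∧ @TopologicalSpace.MetrizableSpace E σ ∧ τ ≤ σ

/-- The restriction of `τ` to the band generated by `x`. -/
abbrev restrictBand (τ : TopologicalSpace E) (x : E) : TopologicalSpace (principalBand x) :=
  τ.induced (Subtype.val : principalBand x → E)

/-- `τ` is locally solidly submetrisable: its restrictions to all principal bands are solidly
submetrisable. -/
def IsLocallySolidlySubmetrisable (τ : TopologicalSpace E) : Prop :=
  ∀ x : E, IsSolidlySubmetrisable (restrictBand τ x)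

/-- Cauchy sequences for a linear topology. -/
def IsCauchySequence (τ : TopologicalSpace E) (s : ℕ → E) : Prop :=
  ∀ U ∈ @nhds E τ 0, ∃ N : ℕ, ∀ m ≥ N, ∀ n ≥ N, s m - s n ∈ U

/-- `τ` is locally interval complete solidly submetrisable: for all `x ≥ 0`, its restriction to
`B_x` is finer than a metrisable locally solid topology on `B_x` for which every Cauchy sequence
in the order interval `[0, x]` converges to an element of `[0, x]`. -/
def IsLocallyIntervalCompleteSolidlySubmetrisable (τ : TopologicalSpace E) : Prop :=
  ∀ x : E, 0 ≤ x → ∃ σ : TopologicalSpace (principalBand x),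
    IsLocallySolid σ ∧ @TopologicalSpace.MetrizableSpace (principalBand x) σ ∧
    restrictBand τ x ≤ σ ∧
    ∀ s : ℕ → principalBand x, (∀ n, (s n : E) ∈ Icc 0 x) → IsCauchySequence σ s →
      ∃ y : principalBand x, (y : E) ∈ Icc 0 x ∧ Tendsto s atTop (@nhds (principalBand x) σ y)

end Topologies

/-- `ι : E → F` exhibits `F` as the Dedekind completion of `E`: `F` is a Dedekind complete vector
lattice and `ι` identifies `E` with an order dense and majorising vector sublattice of `F`. This
determines `F` up to an isomorphism over `E`. -/
structure IsDedekindCompletion {E : Type u} [AddCommGroup E] [Module ℝ E] [Lattice E]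
    [IsOrderedAddMonoid E] [IsOrderedModule ℝ E] {F : Type v} [AddCommGroup F] [Module ℝ F]
    [Lattice F] [IsOrderedAddMonoid F] [IsOrderedModule ℝ F] (ι : E →ₗ[ℝ] F) : Prop where
  isDedekindComplete : IsDedekindComplete F
  injective : Function.Injective ι
  map_sup : ∀ x y : E, ι (x ⊔ y) = ι x ⊔ ι y
  map_inf : ∀ x y : E, ι (x ⊓ y) = ι x ⊓ ι y
  orderDense : ∀ z : F, 0 < z → ∃ x : E, 0 < ι x ∧ ι x ≤ z
  majorising : ∀ z : F, ∃ x : E, z ≤ ι x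

end VectorLattice

/-!
The carrier `C_τ` is the hub of the proof: every other condition is compared with `C_τ = E`, or with
the same equality for the Dedekind completion.

*Submetrisability.* Let `V` be a normal sequence with intersection `N`. If `x` is disjoint from `N`,
then so is the whole band `B_x`, so that the traces of the sets `V n` on `B_x` have intersection
`{0}`; they form a neighbourhood basis at zero of a metrisable locally solid topology on `B_x` that
is coarser than `τ` (`exists_metrizable_principalBand`). Conversely, if solid sets `U n` define a
coarser metrisable locally solid topology on `B_x`, then the sets `{y | |y| ⊓ |x| ∈ U n}` form a
normal sequence on `E`, because truncation by `|x|` is subadditive, and their intersection consists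
of elements disjoint from `x` (`mem_carrier_of_metrizable`). This argument works for every locally
solid topology.

*Passage to the completion.* Normal sequences are pulled back along the embedding in one direction
and extended in the other; order density transports disjointness from the intersection, and since
the lattice is majorising and the carrier is solid it is enough to consider images of elements of
`E` (`IsDedekindCompletion.carrier_eq_univ_iff`).

*Interval completeness.* In a Dedekind complete lattice with a Fatou topology, the sets of a normal
sequence may be taken order closed. A sequence in `[0, x]` whose `n`-th increment lies in the
`(n + 1)`-st set then has an order limit inferior, and order closedness carries the estimates for
finite partial suprema over to it (`exists_limit_of_increments`).

*The countable sup property.* If `C_τ = E` and `τ` is o-Lebesgue, the net of finite suprema of a set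
`S` converges to `sup S`. A sequence of finite suprema that approximates `sup S` within the members
of a suitable normal sequence has the same supremum (`IsOLebesgue.countableSupProperty`).
Conversely, the carrier of a Fatou topology is an order dense ideal, so by the Archimedean property
each `x ≥ 0` is the supremum of the elements of the carrier in `[0, x]`. The countable sup property
reduces this to a countable supremum, and countably many normal sequences can be merged into one
(`IsFatou.carrier_eq_univ`).
-/

namespace VectorLattice

open Set Filter Topology LatticeOrderedAddCommGroup
open scoped Pointwise

/-! ### Disjointness and order closed sets -/

section Order

variable {E : Type u} [AddCommGroup E] [Lattice E]

theorem iInter_isSolid {V : ℕ → Set E} (hV : ∀ n, IsSolid (V n)) : IsSolid (⋂ n, V n) :=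
  fun _ hx _ hyx => mem_iInter.2 fun n => hV n (mem_iInter.1 hx n) hyx

theorem iInter_isOrderClosed {V : ℕ → Set E} (hV : ∀ n, IsOrderClosed (V n)) :
    IsOrderClosed (⋂ n, V n) :=
  fun A _ _ _ f x hf hfx =>
    mem_iInter.2 fun n => hV n A f x (fun a => mem_iInter.1 (hf a) n) hfx

theorem neg_mem_of_isSolid {S : Set E} (hS : IsSolid S) {x : E} (hx : x ∈ S) : -x ∈ S :=
  hS hx (abs_neg x).le

theorem disjointComplement_anti {S T : Set E} (h : S ⊆ T) :
    disjointComplement T ⊆ disjointComplement S :=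
  fun _ hy z hz => hy z (h hz)

variable [IsOrderedAddMonoid E]

theorem add_inf_le_add_inf {a b c : E} (ha : 0 ≤ a) (hb : 0 ≤ b) (hc : 0 ≤ c) :
    (a + b) ⊓ c ≤ a ⊓ c + b ⊓ c := by
  rw [inf_add, add_inf, add_inf]
  refine le_inf (le_inf inf_le_left ?_) (le_inf ?_ ?_)
  · exact inf_le_right.trans (le_add_of_nonneg_left ha)
  · exact inf_le_right.trans (le_add_of_nonneg_right hb)
  · exact inf_le_right.trans (le_add_of_nonneg_right hc)

/-- The truncation `y ↦ |y| ⊓ a` is subadditive. -/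
theorem abs_add_inf_le {y z a : E} (ha : 0 ≤ a) : |y + z| ⊓ a ≤ |y| ⊓ a + |z| ⊓ a :=
  (inf_le_inf_right a (abs_add_le y z)).trans
    (add_inf_le_add_inf (abs_nonneg y) (abs_nonneg z) ha)

theorem eq_zero_of_abs_eq_zero {a : E} (h : |a| = 0) : a = 0 :=
  le_antisymm ((le_abs_self a).trans h.le) (neg_nonpos.1 ((neg_le_abs a).trans h.le))

theorem zero_mem_of_isSolid {S : Set E} (hS : IsSolid S) {x : E} (hx : x ∈ S) : (0 : E) ∈ S :=
  hS hx (by rw [abs_zero]; exact abs_nonneg x)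

theorem mem_of_isSolid_of_le {S : Set E} (hS : IsSolid S) {x y : E} (hx : x ∈ S) (hy : 0 ≤ y)
    (hyx : y ≤ x) : y ∈ S :=
  hS hx (by rwa [abs_of_nonneg hy, abs_of_nonneg (hy.trans hyx)])

theorem isSolid_disjointComplement (S : Set E) : IsSolid (disjointComplement S) :=
  fun _ hx _ hyx z hz =>
    le_antisymm ((inf_le_inf_right _ hyx).trans (hx z hz).le) (le_inf (abs_nonneg _) (abs_nonneg _))

theorem add_mem_disjointComplement {S : Set E} {x y : E} (hx : x ∈ disjointComplement S)
    (hy : y ∈ disjointComplement S) : x + y ∈ disjointComplement S := fun z hz =>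
  le_antisymm ((abs_add_inf_le (abs_nonneg z)).trans (by rw [hx z hz, hy z hz, add_zero]))
    (le_inf (abs_nonneg _) (abs_nonneg _))

theorem nsmul_mem_disjointComplement {S : Set E} {x : E} (n : ℕ)
    (hx : x ∈ disjointComplement S) : n • x ∈ disjointComplement S := by
  induction n with
  | zero => simpa using zero_mem_of_isSolid (isSolid_disjointComplement S) hx
  | succ n ih => exact (succ_nsmul x n).symm ▸ add_mem_disjointComplement ih hx

theorem isOrderClosed_disjointComplement (S : Set E) : IsOrderClosed (disjointComplement S) := by
  rintro A _ _ _ f x hf ⟨B, _, _, _, y, -, hy0, hy⟩ z hz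
  refine le_antisymm (hy0.2 ?_) (le_inf (abs_nonneg _) (abs_nonneg _))
  rintro _ ⟨b, rfl⟩
  obtain ⟨a, ha⟩ := hy b
  have h1 : |x| ⊓ |z| ≤ |x - f a| ⊓ |z| + |f a| ⊓ |z| := by
    simpa using abs_add_inf_le (y := x - f a) (z := f a) (abs_nonneg z)
  rw [hf a z hz, add_zero, abs_sub_comm] at h1
  exact h1.trans (inf_le_left.trans (ha a le_rfl))

/-- A disjoint complement is closed under suprema of positive sets. -/
theorem mem_disjointComplement_of_isLUB {S T : Set E} {x : E} (hx : 0 ≤ x)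
    (hT : ∀ t ∈ T, 0 ≤ t ∧ t ∈ disjointComplement S) (hTx : IsLUB T x) :
    x ∈ disjointComplement S := by
  intro z hz
  rw [abs_of_nonneg hx]
  refine le_antisymm ?_ (le_inf hx (abs_nonneg _))
  -- every `t ∈ T` is disjoint from `x ⊓ |z|`, so that `t + x ⊓ |z| = t ⊔ (x ⊓ |z|) ≤ x`
  have h : x ≤ x - x ⊓ |z| := hTx.2 fun t ht => by
    have h0 : t ⊓ (x ⊓ |z|) = 0 := by
      refine le_antisymm ((inf_le_inf_left t inf_le_right).trans ?_)
        (le_inf (hT t ht).1 (le_inf hx (abs_nonneg z)))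
      have := (hT t ht).2 z hz
      rw [abs_of_nonneg (hT t ht).1] at this
      exact this.le
    have h2 := inf_add_sup t (x ⊓ |z|)
    rw [h0, zero_add] at h2
    exact le_sub_iff_add_le.2 (h2 ▸ sup_le (hTx.1 ht) inf_le_left)
  simpa using h

/-- A directed set, regarded as an increasing net, order converges to its supremum. -/
theorem orderConverges_of_isLUB {D : Set E} (hne : D.Nonempty) (hD : DirectedOn (· ≤ ·) D) {x : E}
    (hx : IsLUB D x) : OrderConverges (Subtype.val : D → E) x := by
  have : IsDirectedOrder D := hD.isDirectedOrder
  refine ⟨D, inferInstance, this, hne.to_subtype, fun d => x - d,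
    fun a b hab => sub_le_sub_left (α := E) hab x, ⟨?_, ?_⟩, fun b => ⟨b, fun a hab => ?_⟩⟩
  · rintro _ ⟨d, rfl⟩
    exact sub_nonneg.2 (hx.1 d.2)
  · intro b hb
    have h : x ≤ x - b := hx.2 fun d hd => le_sub_comm.1 (hb ⟨⟨d, hd⟩, rfl⟩)
    simpa using h
  · rw [abs_sub_comm, abs_of_nonneg (sub_nonneg.2 (hx.1 a.2))]
    exact sub_le_sub_left (α := E) hab x

theorem IsOrderClosed.mem_of_isLUB {S D : Set E} (hS : IsOrderClosed S) (hDS : D ⊆ S)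
    (hne : D.Nonempty) (hD : DirectedOn (· ≤ ·) D) {x : E} (hx : IsLUB D x) : x ∈ S := by
  have : IsDirectedOrder D := hD.isDirectedOrder
  have := hne.to_subtype
  exact hS D _ x (fun d => hDS d.2) (orderConverges_of_isLUB hne hD hx)

theorem IsOrderClosed.mem_of_isLUB_range {S : Set E} (hS : IsOrderClosed S) {u : ℕ → E}
    (hu : Monotone u) (huS : ∀ n, u n ∈ S) {x : E} (hx : IsLUB (range u) x) : x ∈ S :=
  hS.mem_of_isLUB (range_subset_iff.2 huS) (range_nonempty u)
    (directedOn_range.2 hu.directed_le) hx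

/-- In an Archimedean vector lattice, a positive element of the double disjoint complement of an
ideal `I` is the supremum of the positive elements of `I` below it; of the ideal, only solidity and
closedness under addition are used. If `b` is an upper bound of these elements, `x - b ⊓ x` is
disjoint from `I`: its infimum with a member of `I` could be added to them arbitrarily often. -/
theorem isLUB_inter_Icc_of_mem_disjointComplement (hE : IsArchimedean E) {I : Set E}
    (h0 : (0 : E) ∈ I) (hI : IsSolid I) (hadd : ∀ y ∈ I, ∀ z ∈ I, y + z ∈ I) {x : E} (hx : 0 ≤ x)
    (hxI : x ∈ disjointComplement (disjointComplement I)) : IsLUB (I ∩ Icc 0 x) x := by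
  refine ⟨fun y hy => hy.2.2, fun b hb => ?_⟩
  have hb0 : 0 ≤ b ⊓ x := le_inf (hb ⟨h0, le_rfl, hx⟩) hx
  have hc0 : 0 ≤ x - b ⊓ x := sub_nonneg.2 inf_le_right
  have hcx : x - b ⊓ x ≤ x := sub_le_self x hb0
  have hc : x - b ⊓ x ∈ disjointComplement I := by
    intro z hz
    rw [abs_of_nonneg hc0]
    have hw0 : 0 ≤ (x - b ⊓ x) ⊓ |z| := le_inf hc0 (abs_nonneg z)
    have hw : (x - b ⊓ x) ⊓ |z| ∈ I :=
      hI hz (by rw [abs_of_nonneg hw0]; exact inf_le_right)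
    -- all multiples of this element of `I` stay below `x`
    have hn : ∀ n : ℕ, n • ((x - b ⊓ x) ⊓ |z|) ∈ I ∩ Icc 0 x := by
      intro n
      induction n with
      | zero => simpa using ⟨h0, hx⟩
      | succ n ih =>
        rw [succ_nsmul]
        refine ⟨hadd _ ih.1 _ hw, add_nonneg ih.2.1 hw0, ?_⟩
        calc _ ≤ b ⊓ x + (x - b ⊓ x) := add_le_add (le_inf (hb ih) ih.2.2) inf_le_left
          _ = x := by abel
    exact le_antisymm (hE _ x fun n => (hn n).2.2) hw0
  have h := hxI _ hc
  rw [abs_of_nonneg hx, abs_of_nonneg hc0, inf_eq_right.2 hcx, sub_eq_zero] at h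
  exact h.le.trans inf_le_left

end Order

section Band

variable {E : Type u} [AddCommGroup E] [Module ℝ E] [Lattice E]

theorem mem_principalBand_self (x : E) : x ∈ principalBand x :=
  Submodule.mem_sInf.2 fun _ hB => hB.2

variable [IsOrderedModule ℝ E]

theorem abs_smul_le (r : ℝ) (x : E) : |r • x| ≤ |r| • |x| := by
  rcases le_total 0 r with hr | hr
  · rw [abs_of_nonneg hr]
    refine sup_le (smul_le_smul_of_nonneg_left (le_abs_self x) hr) ?_
    rw [← smul_neg]
    exact smul_le_smul_of_nonneg_left (neg_le_abs x) hr
  · rw [abs_of_nonpos hr]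
    refine sup_le ?_ ?_
    · rw [← neg_smul_neg]
      exact smul_le_smul_of_nonneg_left (neg_le_abs x) (neg_nonneg.2 hr)
    · rw [← neg_smul]
      exact smul_le_smul_of_nonneg_left (le_abs_self x) (neg_nonneg.2 hr)

variable [IsOrderedAddMonoid E]

theorem smul_mem_of_isSolid {S : Set E} (hS : IsSolid S) {r : ℝ} {k : ℕ} (hr : |r| ≤ k) {x : E}
    (hx : k • |x| ∈ S) : r • x ∈ S := by
  refine hS hx ((abs_smul_le r x).trans (le_trans ?_ (le_abs_self _)))
  rw [← Nat.cast_smul_eq_nsmul ℝ]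
  exact smul_le_smul_of_nonneg_right hr (abs_nonneg x)

theorem principalBand_subset_disjointComplement {S : Set E} {x : E}
    (hx : x ∈ disjointComplement S) : (principalBand x : Set E) ⊆ disjointComplement S := by
  let D : Submodule ℝ E :=
    { carrier := disjointComplement S
      add_mem' := add_mem_disjointComplement
      zero_mem' := zero_mem_of_isSolid (isSolid_disjointComplement S) hx
      smul_mem' := fun r y hy => by
        obtain ⟨k, hk⟩ := exists_nat_ge |r|
        exact smul_mem_of_isSolid (isSolid_disjointComplement S) hk
          (nsmul_mem_disjointComplement k (isSolid_disjointComplement S hy (abs_abs y).le)) }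
  intro y hy
  exact Submodule.mem_sInf.1 hy D
    ⟨⟨isSolid_disjointComplement S, isOrderClosed_disjointComplement S⟩, hx⟩

end Band

/-! ### Normal sequences and the topologies they generate -/

section NormalSeq

variable {E : Type u} [AddCommGroup E] [Lattice E] {τ : TopologicalSpace E} {V : ℕ → Set E}

theorem IsNormalSeq.zero_mem (hV : IsNormalSeq τ V) (n : ℕ) : (0 : E) ∈ V n :=
  @mem_of_mem_nhds E τ _ _ (hV.1 n).1

theorem IsNormalSeq.add_mem (hV : IsNormalSeq τ V) {n : ℕ} {x y : E} (hx : x ∈ V (n + 1))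
    (hy : y ∈ V (n + 1)) : x + y ∈ V n :=
  hV.2 n (Set.add_mem_add hx hy)

theorem IsNormalSeq.antitone (hV : IsNormalSeq τ V) : Antitone V :=
  antitone_nat_of_succ_le fun n x hx => by simpa using hV.add_mem hx (hV.zero_mem (n + 1))

theorem IsNormalSeq.two_pow_nsmul_mem (hV : IsNormalSeq τ V) (n k : ℕ) {x : E}
    (hx : x ∈ V (n + k)) : 2 ^ k • x ∈ V n := by
  induction k generalizing x with
  | zero => simpa using hx
  | succ k ih =>
    rw [pow_succ, mul_smul, two_nsmul]
    exact ih (hV.add_mem hx hx)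

theorem IsNormalSeq.isSolid_iInter (hV : IsNormalSeq τ V) : IsSolid (⋂ n, V n) :=
  iInter_isSolid fun n => (hV.1 n).2

theorem IsNormalSeq.add_mem_iInter (hV : IsNormalSeq τ V) {x y : E} (hx : x ∈ ⋂ n, V n)
    (hy : y ∈ ⋂ n, V n) : x + y ∈ ⋂ n, V n :=
  mem_iInter.2 fun n => hV.add_mem (mem_iInter.1 hx (n + 1)) (mem_iInter.1 hy (n + 1))

theorem isNormalSeq_univ : IsNormalSeq τ fun _ => univ :=
  ⟨fun _ => ⟨univ_mem, fun _ _ _ _ => mem_univ _⟩, fun _ => subset_univ _⟩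

/-- One normal sequence serves countably many elements of the carrier: the `n`-th set is the
intersection of the `n`-th sets of the first `n + 1` sequences. -/
theorem exists_isNormalSeq_of_countable {T : Set E} (hT : T.Countable) (hTc : T ⊆ carrier τ) :
    ∃ V, IsNormalSeq τ V ∧ T ⊆ disjointComplement (⋂ n, V n) := by
  rcases T.eq_empty_or_nonempty with rfl | hne
  · exact ⟨_, isNormalSeq_univ, empty_subset _⟩
  obtain ⟨f, rfl⟩ := hT.exists_eq_range hne
  choose V hV hf using fun k => hTc (mem_range_self k)
  refine ⟨fun n => ⋂ k ∈ Finset.range (n + 1), V k n, ⟨fun n => ⟨?_, ?_⟩, fun n => ?_⟩, ?_⟩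
  · exact (@Filter.biInter_finset_mem _ _ _ _ _).2 fun k _ => ((hV k).1 n).1
  · intro x hx y hyx
    simp only [mem_iInter] at hx ⊢
    exact fun k hk => ((hV k).1 n).2 (hx k hk) hyx
  · rintro _ ⟨x, hx, y, hy, rfl⟩
    simp only [mem_iInter, Finset.mem_range] at hx hy ⊢
    exact fun k hk => (hV k).add_mem (hx k (by omega)) (hy k (by omega))
  · rintro _ ⟨k, rfl⟩
    refine disjointComplement_anti (fun x hx => mem_iInter.2 fun n => ?_) (hf k)
    have h := mem_iInter.1 hx (n + k)
    simp only [mem_iInter, Finset.mem_range] at h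
    exact (hV k).antitone (Nat.le_add_right n k) (h k (by omega))

variable [IsOrderedAddMonoid E]

theorem isSolid_carrier (τ : TopologicalSpace E) : IsSolid (carrier τ) :=
  fun _ ⟨V, hV, hx⟩ _ hyx => ⟨V, hV, isSolid_disjointComplement _ hx hyx⟩

theorem mem_carrier_of_abs {x : E} (hx : |x| ∈ carrier τ) : x ∈ carrier τ :=
  isSolid_carrier τ hx (by rw [abs_abs])

theorem zero_mem_carrier : (0 : E) ∈ carrier τ :=
  ⟨_, isNormalSeq_univ, fun z _ => by rw [abs_zero, inf_eq_left]; exact abs_nonneg z⟩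

theorem add_mem_carrier {x y : E} (hx : x ∈ carrier τ) (hy : y ∈ carrier τ) :
    x + y ∈ carrier τ := by
  obtain ⟨V, hV, h⟩ := exists_isNormalSeq_of_countable (T := {x, y}) (by simp)
    (insert_subset hx (singleton_subset_iff.2 hy))
  exact ⟨V, hV, add_mem_disjointComplement (h (by simp)) (h (by simp))⟩

end NormalSeq

section Topology

variable {E : Type u} [AddCommGroup E] [Module ℝ E] [Lattice E] {τ : TopologicalSpace E}

/-- If the neighbourhoods of zero with a property `P` form a basis, then every sequence of
neighbourhoods can be refined to a halving sequence of neighbourhoods with `P`. -/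
theorem exists_halving_seq (hτ : IsLocallySolid τ) {P : Set E → Prop}
    (hP : ∀ U ∈ @nhds E τ 0, ∃ V ∈ @nhds E τ 0, P V ∧ V ⊆ U) {O : ℕ → Set E}
    (hO : ∀ n, O n ∈ @nhds E τ 0) :
    ∃ W : ℕ → Set E, (∀ n, W n ∈ @nhds E τ 0 ∧ P (W n) ∧ W n ⊆ O n) ∧
      ∀ n, W (n + 1) + W (n + 1) ⊆ W n := by
  let := τ
  have := hτ.isTopologicalAddGroup
  have hstep : ∀ n, ∀ U : {U : Set E // U ∈ 𝓝 (0 : E)}, ∃ V : {V : Set E // V ∈ 𝓝 (0 : E)},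
      P V ∧ V.1 ⊆ O n ∧ V.1 + V.1 ⊆ U.1 := by
    rintro n ⟨U, hU⟩
    obtain ⟨V, hV, hVU⟩ := exists_nhds_zero_half hU
    obtain ⟨V', hV', hPV', hV'V⟩ := hP (V ∩ O n) (inter_mem hV (hO n))
    refine ⟨⟨V', hV'⟩, hPV', fun x hx => (hV'V hx).2, ?_⟩
    rintro _ ⟨x, hx, y, hy, rfl⟩
    exact hVU x (hV'V hx).1 y (hV'V hy).1
  choose f hfP hfO hf using hstep
  let W : ℕ → {U : Set E // U ∈ 𝓝 (0 : E)} :=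
    fun n => Nat.rec (f 0 ⟨univ, univ_mem⟩) (fun n U => f (n + 1) U) n
  refine ⟨fun n => (W n).1, fun n => ⟨(W n).2, ?_⟩, fun n => hf (n + 1) (W n)⟩
  cases n with
  | zero => exact ⟨hfP 0 _, hfO 0 _⟩
  | succ n => exact ⟨hfP (n + 1) _, hfO (n + 1) _⟩

theorem IsLocallySolid.exists_isNormalSeq (hτ : IsLocallySolid τ) {O : ℕ → Set E}
    (hO : ∀ n, O n ∈ @nhds E τ 0) : ∃ W, IsNormalSeq τ W ∧ ∀ n, W n ⊆ O n := by
  obtain ⟨W, hW, hadd⟩ := exists_halving_seq hτ hτ.solid_basis hO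
  exact ⟨W, ⟨fun n => ⟨(hW n).1, (hW n).2.1⟩, hadd⟩, fun n => (hW n).2.2⟩

theorem IsFatou.exists_isNormalSeq (hτ : IsFatou τ) {O : ℕ → Set E}
    (hO : ∀ n, O n ∈ @nhds E τ 0) :
    ∃ W, IsNormalSeq τ W ∧ (∀ n, IsOrderClosed (W n)) ∧ ∀ n, W n ⊆ O n := by
  obtain ⟨W, hW, hadd⟩ := exists_halving_seq hτ.isLocallySolid
    (P := fun V => IsSolid V ∧ IsOrderClosed V)
    (fun U hU => by simpa only [and_assoc] using hτ.orderClosed_basis U hU) hO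
  exact ⟨W, ⟨fun n => ⟨(hW n).1, (hW n).2.1.1⟩, hadd⟩, fun n => (hW n).2.1.2,
    fun n => (hW n).2.2⟩

variable [IsOrderedAddMonoid E] [IsOrderedModule ℝ E]

theorem IsLocallySolid.restrictBand (hτ : IsLocallySolid τ) (x : E) :
    IsLocallySolid (restrictBand τ x) := by
  let := τ
  have := hτ.isTopologicalAddGroup
  have := hτ.continuousSMul
  have := hτ.t2Space
  refine ⟨inferInstanceAs (IsTopologicalAddGroup (principalBand x)),
    inferInstanceAs (ContinuousSMul ℝ (principalBand x)),
    inferInstanceAs (T2Space (principalBand x)), fun U hU => ?_⟩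
  rw [nhds_induced, mem_comap] at hU
  obtain ⟨O, hO, hOU⟩ := hU
  obtain ⟨S, hS, hSs, hSO⟩ := hτ.solid_basis O hO
  refine ⟨Subtype.val ⁻¹' S, ?_, fun a ha b hba => hSs ha hba, (preimage_mono hSO).trans hOU⟩
  rw [nhds_induced]
  exact preimage_mem_comap hS

/-- A normal sequence with trivial intersection is a neighbourhood basis at zero of a metrisable
locally solid topology. The ambient topology enters only to make its members absorbing. -/
theorem exists_metrizable_of_isNormalSeq (hτ : IsLocallySolid τ) {V : ℕ → Set E}
    (hV : IsNormalSeq τ V) (h0 : ⋂ n, V n = {0}) :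
    ∃ σ : TopologicalSpace E, IsLocallySolid σ ∧ @TopologicalSpace.MetrizableSpace E σ ∧ τ ≤ σ ∧
      (@nhds E σ 0).HasBasis (fun _ => True) V := by
  let B : AddGroupFilterBasis E := addGroupFilterBasisOfComm (range V) (range_nonempty V)
    (by
      rintro _ _ ⟨m, rfl⟩ ⟨n, rfl⟩
      exact ⟨_, ⟨max m n, rfl⟩, subset_inter (hV.antitone (le_max_left m n))
        (hV.antitone (le_max_right m n))⟩)
    (by rintro _ ⟨n, rfl⟩; exact hV.zero_mem n)
    (by rintro _ ⟨n, rfl⟩; exact ⟨_, ⟨n + 1, rfl⟩, hV.2 n⟩)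
    (by rintro _ ⟨n, rfl⟩; exact ⟨_, ⟨n, rfl⟩, fun x hx => neg_mem_of_isSolid (hV.1 n).2 hx⟩)
  let σ : TopologicalSpace E := B.topology
  have hσg : @IsTopologicalAddGroup E σ _ := B.isTopologicalAddGroup
  have hbasis : (@nhds E σ 0).HasBasis (fun _ => True) V := by
    refine ⟨fun U => ?_⟩
    rw [B.nhds_zero_hasBasis.mem_iff]
    constructor
    · rintro ⟨_, ⟨n, rfl⟩, h⟩
      exact ⟨n, trivial, h⟩
    · rintro ⟨n, -, h⟩
      exact ⟨V n, ⟨n, rfl⟩, h⟩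
  have hτσ : τ ≤ σ := by
    rw [← @continuous_id_iff_le]
    refine @continuous_of_continuousAt_zero E τ _ hτ.isTopologicalAddGroup E (E →+ E) _ σ
      hσg.toContinuousAdd _ _ (AddMonoidHom.id E) ?_
    exact hbasis.tendsto_right_iff.2 fun n _ => (hV.1 n).1
  have hσt : @T2Space E σ := by
    refine (@AddGroupFilterBasis.t2Space_iff_sInter_subset E _ σ B rfl).2 fun x hx => ?_
    exact h0.subset (mem_iInter.2 fun n => hx _ ⟨n, rfl⟩)
  have hσs : @ContinuousSMul ℝ E _ _ σ := by
    refine @ContinuousSMul.of_basis_zero ℝ E _ _ _ _ ℕ _ σ hσg _ _ hbasis ?_ ?_ ?_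
    · intro n _
      refine ⟨Metric.ball 0 1, Metric.ball_mem_nhds 0 one_pos, n, trivial, ?_⟩
      rintro _ ⟨r, hr, x, hx, rfl⟩
      refine smul_mem_of_isSolid (hV.1 n).2 (k := 1) ?_ ?_
      · simpa using (mem_ball_zero_iff.1 hr).le
      · simpa using (hV.1 n).2 hx (abs_abs x).le
    · intro r n _
      obtain ⟨k, hk⟩ := pow_unbounded_of_one_lt |r| (one_lt_two : (1 : ℝ) < 2)
      refine ⟨n + k, trivial, fun x hx => ?_⟩
      refine smul_mem_of_isSolid (hV.1 n).2 (k := 2 ^ k) (by exact_mod_cast hk.le) ?_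
      exact hV.two_pow_nsmul_mem n k ((hV.1 _).2 hx (abs_abs x).le)
    · intro x n _
      let := τ
      have := hτ.continuousSMul
      have h : Tendsto (fun r : ℝ => r • x) (𝓝 0) (𝓝 ((0 : ℝ) • x)) :=
        tendsto_id.smul_const x
      rw [zero_smul] at h
      exact h (hV.1 n).1
  refine ⟨σ, ⟨hσg, hσs, hσt, fun U hU => ?_⟩, ?_, hτσ, hbasis⟩
  · obtain ⟨n, -, hn⟩ := hbasis.mem_iff.1 hU
    exact ⟨V n, hbasis.mem_of_mem trivial, (hV.1 n).2, hn⟩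
  · let := σ
    let : UniformSpace E := IsTopologicalAddGroup.rightUniformSpace E
    have := isUniformAddGroup_of_addCommGroup (G := E)
    have : (𝓝 (0 : E)).IsCountablyGenerated :=
      HasCountableBasis.isCountablyGenerated ⟨hbasis, to_countable _⟩
    have := IsUniformAddGroup.uniformity_countably_generated (α := E)
    exact UniformSpace.metrizableSpace

end Topology

/-! ### Submetrisability and the carrier -/

section Carrier

variable {E : Type u} [AddCommGroup E] [Module ℝ E] [Lattice E] [IsOrderedAddMonoid E]
  [IsOrderedModule ℝ E] {τ : TopologicalSpace E}

/-- A normal sequence witnessing that `x` is in the carrier restricts to a neighbourhood basis of a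
metrisable locally solid topology on `B_x`, since `B_x` is disjoint from its intersection. -/
theorem exists_metrizable_principalBand (hτ : IsLocallySolid τ) {V : ℕ → Set E}
    (hV : IsNormalSeq τ V) {x : E} (hx : x ∈ disjointComplement (⋂ n, V n)) :
    ∃ σ : TopologicalSpace (principalBand x), IsLocallySolid σ ∧
      @TopologicalSpace.MetrizableSpace (principalBand x) σ ∧ restrictBand τ x ≤ σ ∧
      (@nhds (principalBand x) σ 0).HasBasis (fun _ => True) fun n => Subtype.val ⁻¹' V n := by
  refine exists_metrizable_of_isNormalSeq (hτ.restrictBand x) ⟨fun n => ⟨?_, ?_⟩, fun n => ?_⟩ ?_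
  · rw [nhds_induced]
    exact preimage_mem_comap (hV.1 n).1
  · exact fun a ha b hba => (hV.1 n).2 ha hba
  · rintro _ ⟨a, ha, b, hb, rfl⟩
    exact hV.add_mem ha hb
  · refine Subset.antisymm (fun a ha => ?_) (singleton_subset_iff.2 ?_)
    · have h := principalBand_subset_disjointComplement hx a.2 a
        (mem_iInter.2 fun n => mem_iInter.1 ha n)
      rw [inf_idem] at h
      exact Subtype.ext (eq_zero_of_abs_eq_zero h)
    · exact mem_iInter.2 fun n => hV.zero_mem n

/-- If a coarser metrisable locally solid topology on `B_x` is given by solid sets `U n`, the sets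
`{y | |y| ⊓ |x| ∈ U n}` form a normal sequence whose intersection is disjoint from `x`. -/
theorem mem_carrier_of_metrizable (hτ : IsLocallySolid τ) {x : E}
    {σ : TopologicalSpace (principalBand x)} (hσ : IsLocallySolid σ)
    (hσm : @TopologicalSpace.MetrizableSpace (principalBand x) σ) (hτσ : restrictBand τ x ≤ σ) :
    x ∈ carrier τ := by
  have hcount : ∃ O : ℕ → Set (principalBand x), (@nhds _ σ 0).HasBasis (fun _ => True) O := by
    let := σ
    let := TopologicalSpace.metrizableSpaceMetric (principalBand x)
    obtain ⟨O, hO⟩ := (𝓝 (0 : principalBand x)).exists_antitone_basis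
    exact ⟨O, hO.1⟩
  obtain ⟨O, hO⟩ := hcount
  obtain ⟨U, hU, hUO⟩ := hσ.exists_isNormalSeq fun n => hO.mem_of_mem (i := n) trivial
  have hmem : ∀ y : E, |y| ⊓ |x| ∈ principalBand x := fun y =>
    isSolid_principalBand x (mem_principalBand_self x) (by
      rw [abs_of_nonneg (le_inf (abs_nonneg y) (abs_nonneg x))]; exact inf_le_right)
  let T : E → principalBand x := fun y => ⟨|y| ⊓ |x|, hmem y⟩
  have hT0 : ∀ y, 0 ≤ T y := fun y => le_inf (abs_nonneg y) (abs_nonneg x)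
  refine ⟨fun n => {y | T y ∈ U n}, ⟨fun n => ⟨?_, ?_⟩, fun n => ?_⟩, fun z hz => ?_⟩
  · have h : U n ∈ @nhds _ (restrictBand τ x) 0 := nhds_mono hτσ (hU.1 n).1
    rw [nhds_induced, mem_comap] at h
    obtain ⟨S, hS, hSU⟩ := h
    obtain ⟨S', hS', hS's, hS'S⟩ := hτ.solid_basis S hS
    refine mem_of_superset hS' fun y hy => hSU (hS'S ?_)
    refine hS's hy ?_
    rw [abs_of_nonneg (le_inf (abs_nonneg y) (abs_nonneg x))]
    exact inf_le_left
  · exact fun y hy z hzy => mem_of_isSolid_of_le (hU.1 n).2 hy (hT0 z) (inf_le_inf_right _ hzy)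
  · rintro _ ⟨y, hy, z, hz, rfl⟩
    exact mem_of_isSolid_of_le (hU.1 n).2 (hU.add_mem hy hz) (hT0 _)
      (abs_add_inf_le (abs_nonneg x))
  · have h : T z ∈ (⋂ n, U n) := mem_iInter.2 fun n => mem_iInter.1 hz n
    have h0 : T z = 0 := by
      by_contra hne
      let := σ
      have := hσ.t2Space
      obtain ⟨n, -, hn⟩ := hO.mem_iff.1 (compl_singleton_mem_nhds (Ne.symm hne))
      exact hn (hUO n (mem_iInter.1 h n)) rfl
    rw [inf_comm]
    exact congrArg Subtype.val h0

theorem isLocallySolidlySubmetrisable_iff (hτ : IsLocallySolid τ) :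
    IsLocallySolidlySubmetrisable τ ↔ carrier τ = univ := by
  refine ⟨fun h => eq_univ_of_forall fun x => ?_, fun h x => ?_⟩
  · obtain ⟨σ, hσ, hσm, hτσ⟩ := h x
    exact mem_carrier_of_metrizable hτ hσ hσm hτσ
  · obtain ⟨V, hV, hx⟩ := h.symm.subset (mem_univ x)
    obtain ⟨σ, hσ, hσm, hτσ, -⟩ := exists_metrizable_principalBand hτ hV hx
    exact ⟨σ, hσ, hσm, hτσ⟩

theorem IsLocallyIntervalCompleteSolidlySubmetrisable.carrier_eq_univ (hτ : IsLocallySolid τ)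
    (h : IsLocallyIntervalCompleteSolidlySubmetrisable τ) : carrier τ = univ := by
  refine eq_univ_of_forall fun x => mem_carrier_of_abs ?_
  obtain ⟨σ, hσ, hσm, hτσ, -⟩ := h |x| (abs_nonneg x)
  exact mem_carrier_of_metrizable hτ hσ hσm hτσ

end Carrier

/-! ### Interval completeness -/

section IntervalComplete

variable {E : Type u} [AddCommGroup E] [Lattice E] [IsOrderedAddMonoid E]
  {τ : TopologicalSpace E}

theorem abs_sub_le_sum_abs_sub (t : ℕ → E) (k i : ℕ) :
    |t (k + i) - t k| ≤ ∑ j ∈ Finset.range i, |t (k + j + 1) - t (k + j)| := by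
  induction i with
  | zero => simp
  | succ i ih =>
    rw [Finset.sum_range_succ]
    calc |t (k + (i + 1)) - t k| = |(t (k + i) - t k) + (t (k + i + 1) - t (k + i))| := by
          rw [← add_assoc]; congr 1; abel
      _ ≤ _ := (abs_add_le _ _).trans (add_le_add_left ih _)

/-- Telescoping along the halving property: `W (k + 1) + W (k + 2) + ⋯ + W (k + i) ⊆ W k`. -/
theorem IsNormalSeq.sum_abs_sub_mem {W : ℕ → Set E} (hW : IsNormalSeq τ W) {t : ℕ → E}
    (ht : ∀ n, t (n + 1) - t n ∈ W (n + 1)) (k i : ℕ) :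
    ∑ j ∈ Finset.range i, |t (k + j + 1) - t (k + j)| ∈ W k := by
  induction i generalizing k with
  | zero => simpa using hW.zero_mem k
  | succ i ih =>
    rw [Finset.sum_range_succ']
    refine hW.add_mem ?_ ((hW.1 _).2 (ht k) (abs_abs _).le)
    have h := ih (k + 1)
    simpa only [add_assoc, add_comm 1] using h

/-- A sequence in `[0, x]` whose increments lie in the successive members of a normal sequence of
order closed sets converges, for that sequence, to its order limit inferior. -/
theorem exists_limit_of_increments (hE : IsDedekindComplete E) {W : ℕ → Set E}
    (hW : IsNormalSeq τ W) (hWc : ∀ n, IsOrderClosed (W n)) {x : E} {t : ℕ → E}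
    (htx : ∀ n, t n ∈ Icc 0 x) (ht : ∀ n, t (n + 1) - t n ∈ W (n + 1)) :
    ∃ y ∈ Icc 0 x, ∀ k, y - t (k + 1) ∈ W k := by
  -- `w k` is the supremum of the differences `t k - t (k + i)`, so that `t k - w k` is the infimum
  -- of the tail of `t` from `k` on
  have hw : ∀ k, ∃ w, IsLUB (range fun i => t k - t (k + i)) w := fun k =>
    hE _ (range_nonempty _) ⟨t k, by
      rintro _ ⟨i, rfl⟩
      exact sub_le_self _ (htx _).1⟩
  choose w hw using hw
  have hwW : ∀ k, w k ∈ W k := by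
    intro k
    have hlub : IsLUB (range (partialSups fun i => t k - t (k + i))) (w k) := by
      rw [IsLUB, upperBounds_range_partialSups]
      exact hw k
    refine (hWc k).mem_of_isLUB_range (partialSups _).monotone (fun j => ?_) hlub
    refine mem_of_isSolid_of_le (hW.1 k).2 (hW.sum_abs_sub_mem ht k j) ?_ ?_
    · simpa using le_partialSups_of_le (fun i => t k - t (k + i)) (Nat.zero_le j)
    · refine partialSups_le _ _ _ fun i hi => ?_
      calc t k - t (k + i) ≤ |t (k + i) - t k| := by
            rw [abs_sub_comm]; exact le_abs_self _
        _ ≤ _ := abs_sub_le_sum_abs_sub t k i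
        _ ≤ _ := Finset.sum_le_sum_of_subset_of_nonneg (Finset.range_mono hi)
            fun _ _ _ => abs_nonneg _
  have hw0 : ∀ k, 0 ≤ w k := fun k => (hw k).1 ⟨0, by simp⟩
  have hu0 : ∀ k, 0 ≤ t k - w k := fun k => sub_nonneg.2 <| (hw k).2 <| by
    rintro _ ⟨i, rfl⟩
    exact sub_le_self _ (htx _).1
  have hux : ∀ k, t k - w k ≤ x := fun k => (sub_le_self _ (hw0 k)).trans (htx k).2
  have hmono : Monotone fun k => t k - w k := monotone_nat_of_le_succ fun k => by
    refine le_sub_comm.1 ((hw (k + 1)).2 ?_)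
    rintro _ ⟨i, rfl⟩
    refine sub_le_sub_left ?_ _
    have h : t k - t (k + (1 + i)) ≤ w k := (hw k).1 ⟨1 + i, rfl⟩
    rw [← add_assoc] at h
    exact sub_le_comm.1 h
  obtain ⟨y, hy⟩ := hE (range fun k => t k - w k) (range_nonempty _) ⟨x, by
    rintro _ ⟨k, rfl⟩
    exact hux k⟩
  -- `t j - w j - t (k + 1)` increases in `j` to `y - t (k + 1)` and is in `W k` for `j ≥ k + 1`
  refine ⟨y, ⟨(hu0 0).trans (hy.1 ⟨0, rfl⟩), hy.2 (by rintro _ ⟨k, rfl⟩; exact hux k)⟩, fun k => ?_⟩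
  refine (hWc k).mem_of_isLUB_range
    (u := fun i => t (k + 1 + i) - w (k + 1 + i) - t (k + 1)) ?_ (fun i => ?_) ⟨?_, fun b hb => ?_⟩
  · exact fun i j hij => sub_le_sub_right (hmono (by omega)) _
  · have h1 : -w (k + 1 + i) ∈ W (k + 1) :=
      neg_mem_of_isSolid (hW.1 _).2 (hW.antitone (by omega) (hwW (k + 1 + i)))
    have h2 : t (k + 1 + i) - t (k + 1) ∈ W (k + 1) :=
      (hW.1 _).2 (hW.sum_abs_sub_mem ht (k + 1) i)
        ((abs_sub_le_sum_abs_sub t (k + 1) i).trans (le_abs_self _))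
    have h := hW.add_mem h1 h2
    rwa [show -w (k + 1 + i) + (t (k + 1 + i) - t (k + 1)) =
      t (k + 1 + i) - w (k + 1 + i) - t (k + 1) by abel] at h
  · rintro _ ⟨i, rfl⟩
    exact sub_le_sub_right (hy.1 ⟨_, rfl⟩) _
  · refine sub_le_iff_le_add.2 (hy.2 ?_)
    rintro _ ⟨i, rfl⟩
    exact (hmono (by omega : i ≤ k + 1 + i)).trans (sub_le_iff_le_add.1 (hb ⟨i, rfl⟩))

variable [Module ℝ E] [IsOrderedModule ℝ E]

theorem IsFatou.isLocallyIntervalCompleteSolidlySubmetrisable (hE : IsDedekindComplete E)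
    (hτ : IsFatou τ) (hc : carrier τ = univ) :
    IsLocallyIntervalCompleteSolidlySubmetrisable τ := by
  intro x _
  obtain ⟨V, hV, hxV⟩ := hc.symm.subset (mem_univ x)
  obtain ⟨W, hW, hWc, hWV⟩ := hτ.exists_isNormalSeq fun n => (hV.1 n).1
  obtain ⟨σ, hσ, hσm, hτσ, hbasis⟩ := exists_metrizable_principalBand hτ.isLocallySolid hW
    (disjointComplement_anti (iInter_mono hWV) hxV)
  refine ⟨σ, hσ, hσm, hτσ, fun s hs hsc => ?_⟩
  have hcau : ∀ n, ∃ N, ∀ m ≥ N, ∀ m' ≥ N, (s m : E) - s m' ∈ W n := fun n =>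
    hsc _ (hbasis.mem_of_mem trivial)
  choose N hN using hcau
  obtain ⟨φ, hφ, hφN⟩ := extraction_forall_of_eventually
    (fun n => eventually_ge_atTop (N (n + 1)))
  obtain ⟨y, hyx, hy⟩ := exists_limit_of_increments hE hW hWc (fun n => hs (φ n))
    (fun n => hN (n + 1) _ ((hφN n).trans (hφ n.lt_succ_self).le) _ (hφN n))
  have hyB : y ∈ principalBand x := isSolid_principalBand x (mem_principalBand_self x)
    (by rw [abs_of_nonneg hyx.1, abs_of_nonneg (hyx.1.trans hyx.2)]; exact hyx.2)
  refine ⟨⟨y, hyB⟩, hyx, ?_⟩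
  let := σ
  have := hσ.isTopologicalAddGroup
  rw [← tendsto_sub_nhds_zero_iff, hbasis.tendsto_right_iff]
  refine fun n _ => eventually_atTop.2 ⟨N (n + 1), fun m hm => ?_⟩
  -- compare `s m` with a term of the subsequence that is far enough out
  let k := max (n + 1) (N (n + 1))
  have h1 : (s m : E) - s (φ (k + 1)) ∈ W (n + 1) :=
    hN (n + 1) m hm _ ((le_max_right _ _).trans ((Nat.le_succ k).trans (hφ.le_apply)))
  have h2 : (s (φ (k + 1)) : E) - y ∈ W (n + 1) := by
    have h := neg_mem_of_isSolid (hW.1 _).2 (hW.antitone (le_max_left _ _) (hy k))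
    rwa [neg_sub] at h
  have h := hW.add_mem h1 h2
  rwa [sub_add_sub_cancel] at h

end IntervalComplete

/-! ### The carrier and the Dedekind completion -/

section Completion

variable {E : Type u} [AddCommGroup E] [Module ℝ E] [Lattice E] [IsOrderedAddMonoid E]
  [IsOrderedModule ℝ E] {F : Type v} [AddCommGroup F] [Module ℝ F] [Lattice F]
  [IsOrderedAddMonoid F] [IsOrderedModule ℝ F] {ι : E →ₗ[ℝ] F}

theorem IsDedekindCompletion.map_abs (hι : IsDedekindCompletion ι) (x : E) : ι |x| = |ι x| := by
  rw [abs, abs, hι.map_sup, map_neg]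

theorem IsDedekindCompletion.map_le_map (hι : IsDedekindCompletion ι) {x y : E} (h : x ≤ y) :
    ι x ≤ ι y := by
  rw [← sup_eq_right, ← hι.map_sup, sup_eq_right.2 h]

theorem IsDedekindCompletion.disjoint_map_iff (hι : IsDedekindCompletion ι) {x y : E} :
    |ι x| ⊓ |ι y| = 0 ↔ |x| ⊓ |y| = 0 := by
  rw [← hι.map_abs, ← hι.map_abs, ← hι.map_inf, map_eq_zero_iff ι hι.injective]

theorem IsDedekindCompletion.mem_carrier_of_map (hι : IsDedekindCompletion ι)
    {τ : TopologicalSpace E} {τδ : TopologicalSpace F} (hext : τ = TopologicalSpace.induced ι τδ)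
    {x : E} (hx : ι x ∈ carrier τδ) : x ∈ carrier τ := by
  obtain ⟨V, hV, hxV⟩ := hx
  refine ⟨fun n => ι ⁻¹' V n, ⟨fun n => ⟨?_, fun a ha b hba => ?_⟩, fun n => ?_⟩, fun y hy => ?_⟩
  · rw [hext, nhds_induced, map_zero]
    exact preimage_mem_comap (hV.1 n).1
  · refine (hV.1 n).2 ha ?_
    rw [← hι.map_abs, ← hι.map_abs]
    exact hι.map_le_map hba
  · rintro _ ⟨a, ha, b, hb, rfl⟩
    simpa using hV.add_mem ha hb
  · exact hι.disjoint_map_iff.1 (hxV (ι y) (mem_iInter.2 fun n => mem_iInter.1 hy n))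

/-- Order density gives the converse: a non-zero element of the completion below `ι x` and in all
members of a normal sequence would dominate a non-zero element of the original lattice. -/
theorem IsDedekindCompletion.map_mem_carrier (hι : IsDedekindCompletion ι)
    {τ : TopologicalSpace E} {τδ : TopologicalSpace F} (hτδ : IsLocallySolid τδ)
    (hext : τ = TopologicalSpace.induced ι τδ) {x : E} (hx : x ∈ carrier τ) :
    ι x ∈ carrier τδ := by
  obtain ⟨V, hV, hxV⟩ := hx
  have hO : ∀ n, ∃ O ∈ @nhds F τδ 0, ι ⁻¹' O ⊆ V n := fun n => by
    have h := (hV.1 n).1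
    rwa [hext, nhds_induced, map_zero] at h
  choose O hO hOV using hO
  obtain ⟨W, hW, hWO⟩ := hτδ.exists_isNormalSeq hO
  refine ⟨W, hW, fun z hz => ?_⟩
  by_contra hne
  have h0 : 0 ≤ |ι x| ⊓ |z| := le_inf (abs_nonneg _) (abs_nonneg _)
  obtain ⟨y, hy0, hy⟩ := hι.orderDense _ (lt_of_le_of_ne h0 (Ne.symm hne))
  have hyV : y ∈ ⋂ n, V n := mem_iInter.2 fun n => hOV n <| hWO n <|
    (hW.1 n).2 (mem_iInter.1 hz n) (by
      rw [abs_of_nonneg hy0.le]; exact hy.trans inf_le_right)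
  have h := hι.disjoint_map_iff.2 (hxV y hyV)
  rw [abs_of_nonneg hy0.le, inf_eq_right.2 (hy.trans inf_le_left)] at h
  exact hy0.ne' h

theorem IsDedekindCompletion.carrier_eq_univ_iff (hι : IsDedekindCompletion ι)
    {τ : TopologicalSpace E} {τδ : TopologicalSpace F} (hτδ : IsLocallySolid τδ)
    (hext : τ = TopologicalSpace.induced ι τδ) : carrier τ = univ ↔ carrier τδ = univ := by
  refine ⟨fun h => eq_univ_of_forall fun z => ?_, fun h => eq_univ_of_forall fun x =>
    hι.mem_carrier_of_map hext (h.symm.subset (mem_univ _))⟩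
  obtain ⟨x, hx⟩ := hι.majorising |z|
  exact isSolid_carrier τδ (hι.map_mem_carrier hτδ hext (h.symm.subset (mem_univ x)))
    (hx.trans (le_abs_self _))

end Completion

/-! ### The countable sup property -/

section CountableSup

variable {E : Type u} [AddCommGroup E] [Module ℝ E] [Lattice E] [IsOrderedAddMonoid E]
  {τ : TopologicalSpace E}

/-- An upward directed set approximates its supremum topologically, beyond any given member. -/
theorem IsOLebesgue.exists_sub_mem (hτ : IsOLebesgue τ) {D : Set E} (hD : DirectedOn (· ≤ ·) D)
    {s x : E} (hs : s ∈ D) (hx : IsLUB D x) {V : Set E} (hV : V ∈ @nhds E τ 0) :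
    ∃ t ∈ D, s ≤ t ∧ t - x ∈ V := by
  have : IsDirectedOrder D := hD.isDirectedOrder
  have : Nonempty D := ⟨⟨s, hs⟩⟩
  have h := hτ.tendsto D _ x (orderConverges_of_isLUB ⟨s, hs⟩ hD hx)
  let := τ
  have := hτ.isLocallySolid.isTopologicalAddGroup
  rw [← tendsto_sub_nhds_zero_iff] at h
  obtain ⟨t, htV, hst⟩ := ((h.eventually_mem hV).and (eventually_ge_atTop ⟨s, hs⟩)).exists
  exact ⟨t, t.2, hst, htV⟩

theorem IsOLebesgue.countableSupProperty (hτ : IsOLebesgue τ) (hc : carrier τ = univ) :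
    CountableSupProperty E := by
  intro S x hSx
  rcases S.eq_empty_or_nonempty with rfl | ⟨s, hs⟩
  · exact ⟨∅, Subset.rfl, countable_empty, hSx⟩
  obtain ⟨V, hV, hxV⟩ := hc.symm.subset (mem_univ (x - s))
  have happ : ∀ n, ∃ t ∈ supClosure S, s ≤ t ∧ t - x ∈ V n := fun n =>
    hτ.exists_sub_mem supClosed_supClosure.directedOn (subset_supClosure hs)
      (isLUB_supClosure.2 hSx) (hV.1 n).1
  choose t htS hst htV using happ
  -- each `t n` is the supremum of a finite subset of `S`; adding `s` to the union of these subsets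
  -- keeps `x - b ⊓ x`, for an upper bound `b`, below `x - s`, which is disjoint from `⋂ n, V n`
  choose G hG hGS hGt using htS
  refine ⟨insert s (⋃ n, (G n : Set E)), insert_subset hs (iUnion_subset hGS),
    (countable_iUnion fun n => (G n).countable_toSet).insert s,
    fun y hy => hSx.1 ((insert_subset hs (iUnion_subset hGS)) hy), fun b hb => ?_⟩
  have htb : ∀ n, t n ≤ b := fun n => by
    rw [← hGt n]
    exact Finset.sup'_le _ _ fun y hy => hb (mem_insert_of_mem _ (mem_iUnion.2 ⟨n, hy⟩))
  have htx : ∀ n, t n ≤ x := fun n => by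
    rw [← hGt n]
    exact Finset.sup'_le _ _ fun y hy => hSx.1 (hGS n hy)
  have h0 : 0 ≤ x - b ⊓ x := sub_nonneg.2 inf_le_right
  have hmem : x - b ⊓ x ∈ ⋂ n, V n := mem_iInter.2 fun n => by
    have h := neg_mem_of_isSolid (hV.1 n).2 (htV n)
    rw [neg_sub] at h
    exact mem_of_isSolid_of_le (hV.1 n).2 h h0 (sub_le_sub_left (le_inf (htb n) (htx n)) x)
  have hle : x - b ⊓ x ≤ x - s :=
    sub_le_sub_left (le_inf (hb (mem_insert _ _)) (hSx.1 hs)) x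
  have h := hxV _ hmem
  rw [abs_of_nonneg h0, abs_of_nonneg (h0.trans hle), inf_eq_right.2 hle, sub_eq_zero] at h
  exact h.le.trans inf_le_left

/-- The carrier of a Fatou topology is order dense: the intersection `N` of a normal sequence of
order closed sets that avoids `|z|` is a band, so `|z|` meets the disjoint complement of `N`. -/
theorem IsFatou.disjointComplement_carrier (hE : IsArchimedean E) (hτ : IsFatou τ) :
    disjointComplement (carrier τ) ⊆ {0} := by
  intro z hz
  by_contra hne
  have hne' : |z| ≠ 0 := fun h => hne (eq_zero_of_abs_eq_zero h)
  have hO : {|z|}ᶜ ∈ @nhds E τ 0 := by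
    let := τ
    have := hτ.isLocallySolid.t2Space
    exact compl_singleton_mem_nhds hne'.symm
  obtain ⟨W, hW, hWc, hWO⟩ := hτ.exists_isNormalSeq fun _ => hO
  have hzN : |z| ∉ disjointComplement (disjointComplement (⋂ n, W n)) := fun h => by
    have hlub := isLUB_inter_Icc_of_mem_disjointComplement hE
      (mem_iInter.2 hW.zero_mem) hW.isSolid_iInter
      (fun _ h₁ _ h₂ => hW.add_mem_iInter h₁ h₂) (abs_nonneg z) h
    have hdir : DirectedOn (· ≤ ·) ((⋂ n, W n) ∩ Icc 0 |z|) := fun a ha b hb =>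
      ⟨a ⊔ b, ⟨mem_of_isSolid_of_le hW.isSolid_iInter (hW.add_mem_iInter ha.1 hb.1)
        (ha.2.1.trans le_sup_left)
        (sup_le (le_add_of_nonneg_right hb.2.1) (le_add_of_nonneg_left ha.2.1)),
        ha.2.1.trans le_sup_left, sup_le ha.2.2 hb.2.2⟩, le_sup_left, le_sup_right⟩
    have hne : ((⋂ n, W n) ∩ Icc 0 |z|).Nonempty :=
      ⟨0, mem_iInter.2 hW.zero_mem, le_rfl, abs_nonneg z⟩
    have hmem : |z| ∈ ⋂ n, W n :=
      (iInter_isOrderClosed hWc).mem_of_isLUB inter_subset_left hne hdir hlub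
    exact hWO 0 (mem_iInter.1 hmem 0) rfl
  refine hzN fun v hv => ?_
  rw [abs_abs]
  exact hz v ⟨W, hW, hv⟩

theorem IsFatou.carrier_eq_univ (hE : IsArchimedean E) (hτ : IsFatou τ)
    (hc : CountableSupProperty E) : carrier τ = univ := by
  refine eq_univ_of_forall fun x => mem_carrier_of_abs ?_
  have hx : |x| ∈ disjointComplement (disjointComplement (carrier τ)) := fun z hz => by
    rw [mem_singleton_iff.1 (hτ.disjointComplement_carrier hE hz), abs_zero]
    exact inf_eq_right.2 (abs_nonneg _)
  obtain ⟨T, hT, hTc, hTx⟩ := hc _ _ (isLUB_inter_Icc_of_mem_disjointComplement hE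
    zero_mem_carrier (isSolid_carrier τ) (fun _ hy _ hz => add_mem_carrier hy hz)
    (abs_nonneg x) hx)
  obtain ⟨V, hV, hTV⟩ := exists_isNormalSeq_of_countable hTc fun y hy => (hT hy).1
  exact ⟨V, hV, mem_disjointComplement_of_isLUB (abs_nonneg x)
    (fun y hy => ⟨(hT hy).2.1, hTV hy⟩) hTx⟩

end CountableSup

end VectorLattice

theorem mainTheorem3
    {E : Type u} [AddCommGroup E] [Module ℝ E] [Lattice E] [IsOrderedAddMonoid E]
    [IsOrderedModule ℝ E] (hE : VectorLattice.IsArchimedean E)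
    {F : Type v} [AddCommGroup F] [Module ℝ F] [Lattice F] [IsOrderedAddMonoid F]
    [IsOrderedModule ℝ F]
    (ι : E →ₗ[ℝ] F) (hι : VectorLattice.IsDedekindCompletion ι)
    (τ : TopologicalSpace E) (hτ : VectorLattice.IsFatou τ)
    (τδ : TopologicalSpace F) (hτδ : VectorLattice.IsFatou τδ)
    (hext : τ = TopologicalSpace.induced ι τδ) :
    [VectorLattice.IsLocallySolidlySubmetrisable τ,
      VectorLattice.IsLocallySolidlySubmetrisable τδ,
      VectorLattice.IsLocallyIntervalCompleteSolidlySubmetrisable τδ,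
      VectorLattice.carrier τ = Set.univ,
      VectorLattice.carrier τδ = Set.univ].TFAE ∧
    (VectorLattice.IsOLebesgue τ →
      [VectorLattice.IsLocallySolidlySubmetrisable τ,
        VectorLattice.IsLocallySolidlySubmetrisable τδ,
        VectorLattice.IsLocallyIntervalCompleteSolidlySubmetrisable τδ,
        VectorLattice.carrier τ = Set.univ,
        VectorLattice.carrier τδ = Set.univ,
        VectorLattice.CountableSupProperty E].TFAE) := by
  have h14 := VectorLattice.isLocallySolidlySubmetrisable_iff hτ.isLocallySolid
  have h25 := VectorLattice.isLocallySolidlySubmetrisable_iff hτδ.isLocallySolid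
  have h45 := hι.carrier_eq_univ_iff hτδ.isLocallySolid hext
  have h35 : VectorLattice.IsLocallyIntervalCompleteSolidlySubmetrisable τδ ↔
      VectorLattice.carrier τδ = Set.univ :=
    ⟨fun h => h.carrier_eq_univ hτδ.isLocallySolid,
      hτδ.isLocallyIntervalCompleteSolidlySubmetrisable hι.isDedekindComplete⟩
  refine ⟨?_, fun hL => ?_⟩
  · tfae_have 1 ↔ 4 := h14
    tfae_have 2 ↔ 5 := h25
    tfae_have 3 ↔ 5 := h35
    tfae_have 4 ↔ 5 := h45
    tfae_finish
  · have h46 : VectorLattice.carrier τ = Set.univ ↔ VectorLattice.CountableSupProperty E :=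
      ⟨hL.countableSupProperty, hτ.carrier_eq_univ hE⟩
    tfae_have 1 ↔ 4 := h14
    tfae_have 2 ↔ 5 := h25
    tfae_have 3 ↔ 5 := h35
    tfae_have 4 ↔ 5 := h45
    tfae_have 4 ↔ 6 := h46
    tfae_finish
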